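/- Let $N\ge 1$ and $\omega\in\mathbb{R}$. Let $H^1(\mathbb{R}^N)$ be the Sobolev space of complex-valued functions $u\in L^2(\mathbb{R}^N)$ with weak gradient $\nabla u\in L^2$, and put $$W(\mathbb{R}^N)=\{u\in H^1(\mathbb{R}^N): |u|^2\log|u|^2\in L^1(\mathbb{R}^N)\}\qquad(0\log 0=0).$$ For $u\in W(\mathbb{R}^N)$ define $$S_\omega(u)=\tfrac12\int_{\mathbb{R}^N}|\nabla u|^2\,dx+\tfrac{\omega+1}{2}\int_{\mathbb{R}^N}|u|^2\,dx-\tfrac12\int_{\mathbb{R}^N}|u|^2\log|u|^2\,dx,$$ $$I_\omega(u)=\int_{\mathbb{R}^N}|\nabla u|^2\,dx+\omega\int_{\mathbb{R}^N}|u|^2\,dx-\int_{\mathbb{R}^N}|u|^2\log|u|^2\,dx,$$ and $$d(\omega)=\inf\{S_\omega(u): u\in W(\mathbb{R}^N)\setminus\{0\},\ I_\omega(u)=0\}=\tfrac12\inf\{\|u\|_{L^2}^2: u\in W(\mathbb{R}^N)\setminus\{0\},\ I_\omega(u)=0\}.$$ Then every $u\in W(\mathbb{R}^N)\setminus\{0\}$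 with $I_\omega(u)=0$ satisfies $$\|u\|_{L^2}^2\ge \pi^{N/2}e^{\omega+N},$$ and the quantity $d(\omega)$ is positive and satisfies $$d(\omega)\ge\tfrac12\pi^{N/2}e^{\omega+N}.$$ -/

import Mathlib

open MeasureTheory

noncomputable section

namespace LogNLS

/-- The space `ℝ^N` with its Euclidean norm. -/
abbrev Space (N : ℕ) : Type := EuclideanSpace ℝ (Fin N)

/-- The complex Hilbert space `L²(ℝ^N, ℂ)` (functions modulo equality almost everywhere). -/
abbrev L2 (N : ℕ) : Type := Lp ℂ 2 (volume : Measure (Space N))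

/-- The space of square integrable vector fields `ℝ^N → ℂ^N`. -/
abbrev L2Vec (N : ℕ) : Type := Lp (EuclideanSpace ℂ (Fin N)) 2 (volume : Measure (Space N))

/-- `g` is the weak (distributional) gradient of `u`:
`∫ u ∂ᵢφ = - ∫ gᵢ φ` for all test functions `φ ∈ C_c^∞(ℝ^N)` and all coordinates `i`. -/
def IsWeakGradient {N : ℕ} (u : L2 N) (g : L2Vec N) : Prop :=
  ∀ φ : Space N → ℝ, ContDiff ℝ (⊤ : ℕ∞) φ → HasCompactSupport φ → ∀ i : Fin N,
    (∫ x, (fderiv ℝ φ x (EuclideanSpace.single i 1)) • u x) = - (∫ x, φ x • (g x i))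

/-- The Sobolev space `H¹(ℝ^N)`: the `L²` functions that have a weak gradient in `L²`. -/
def H1 (N : ℕ) : Set (L2 N) := {u | ∃ g : L2Vec N, IsWeakGradient u g}

/-- Weak gradients are unique. -/
theorem IsWeakGradient.unique {N : ℕ} {u : L2 N} {g h : L2Vec N}
    (hg : IsWeakGradient u g) (hh : IsWeakGradient u h) : g = h := by
  have key : ∀ i : Fin N, ∀ᵐ x : Space N, g x i - h x i = 0 := by
    intro i
    have coord : ∀ k : L2Vec N, MemLp (fun x => k x i) 2 (volume : Measure (Space N)) :=
      fun k => (Lp.memLp k).continuousLinearMap_comp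
        (EuclideanSpace.proj i : EuclideanSpace ℂ (Fin N) →L[ℂ] ℂ)
    have loc : ∀ k : L2Vec N, LocallyIntegrable (fun x => k x i) (volume : Measure (Space N)) :=
      fun k => (coord k).locallyIntegrable (by norm_num)
    refine ae_eq_zero_of_integral_contDiff_smul_eq_zero ((loc g).sub (loc h)) ?_
    intro φ hφ hc
    have ig := (loc g).integrable_smul_left_of_hasCompactSupport hφ.continuous hc
    have ih := (loc h).integrable_smul_left_of_hasCompactSupport hφ.continuous hc
    have e := (hg φ hφ hc i).symm.trans (hh φ hφ hc i)
    simp only [smul_sub]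
    rw [integral_sub ig ih, neg_injective e, sub_self]
  apply Lp.ext
  filter_upwards [ae_all_iff.2 key] with x hx
  ext i
  exact sub_eq_zero.1 (hx i)

open Classical in
/-- The weak gradient `∇u` of `u ∈ H¹(ℝ^N)` (and `0` if `u ∉ H¹(ℝ^N)`). -/
def weakGradient {N : ℕ} (u : L2 N) : L2Vec N :=
  if h : ∃ g : L2Vec N, IsWeakGradient u g then h.choose else 0

/-- `weakGradient u` is the weak gradient of `u` as soon as there is one. -/
theorem IsWeakGradient.weakGradient_eq {N : ℕ} {u : L2 N} {g : L2Vec N}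
    (hg : IsWeakGradient u g) : weakGradient u = g := by
  have h : ∃ g : L2Vec N, IsWeakGradient u g := ⟨g, hg⟩
  rw [weakGradient, dif_pos h]
  exact h.choose_spec.unique hg

/-- The energy space `W(ℝ^N) = {u ∈ H¹(ℝ^N) : |u|² log |u|² ∈ L¹(ℝ^N)}`
(with `0 log 0 = 0`, which is also the convention of `Real.log`). -/
def W (N : ℕ) : Set (L2 N) :=
  {u | u ∈ H1 N ∧ Integrable (fun x => ‖u x‖ ^ 2 * Real.log (‖u x‖ ^ 2)) volume}

/-- The action
`S_ω(u) = ½ ∫ |∇u|² + (ω + 1)/2 ∫ |u|² - ½ ∫ |u|² log |u|²`. -/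
def S {N : ℕ} (ω : ℝ) (u : L2 N) : ℝ :=
  (1 / 2) * (∫ x, ‖weakGradient u x‖ ^ 2)
    + ((ω + 1) / 2) * (∫ x, ‖u x‖ ^ 2)
    - (1 / 2) * (∫ x, ‖u x‖ ^ 2 * Real.log (‖u x‖ ^ 2))

/-- The Nehari functional
`I_ω(u) = ∫ |∇u|² + ω ∫ |u|² - ∫ |u|² log |u|²`. -/
def I {N : ℕ} (ω : ℝ) (u : L2 N) : ℝ :=
  (∫ x, ‖weakGradient u x‖ ^ 2)
    + ω * (∫ x, ‖u x‖ ^ 2)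
    - (∫ x, ‖u x‖ ^ 2 * Real.log (‖u x‖ ^ 2))

/-- The Nehari manifold `{u ∈ W(ℝ^N) \ {0} : I_ω(u) = 0}`. -/
def nehari (N : ℕ) (ω : ℝ) : Set (L2 N) := {u | u ∈ W N ∧ u ≠ 0 ∧ I ω u = 0}

/-- `d(ω) = inf {S_ω(u) : u ∈ W(ℝ^N) \ {0}, I_ω(u) = 0}`. The infimum is taken in `ℝ`; its default
value for a set that is empty or unbounded below is `0`, so that a positive lower bound for `d N ω`
can hold only if it is a genuine infimum. -/
def d (N : ℕ) (ω : ℝ) : ℝ := sInf (S ω '' nehari N ω)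

open scoped Pointwise in
/-- The second expression for `d(ω)`: `d(ω) = ½ inf {‖u‖² : u ∈ W(ℝ^N) \ {0}, I_ω(u) = 0}`. -/
theorem d_eq_half_sInf (N : ℕ) (ω : ℝ) :
    d N ω = (1 / 2) * sInf ((fun u : L2 N => ‖u‖ ^ 2) '' nehari N ω) := by
  have hn : ∀ u : L2 N, ∫ x, ‖u x‖ ^ 2 = ‖u‖ ^ 2 := by
    intro u
    have h := L2.inner_def (𝕜 := ℂ) u u
    simp only [inner_self_eq_norm_sq_to_K] at h
    have h2 : ((‖u‖ ^ 2 : ℝ) : ℂ) = ((∫ x, ‖u x‖ ^ 2 : ℝ) : ℂ) := by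
      rw [← integral_complex_ofReal]
      push_cast
      exact h
    exact_mod_cast h2.symm
  have hS : S ω '' nehari N ω
      = (1 / 2 : ℝ) • ((fun u : L2 N => ‖u‖ ^ 2) '' nehari N ω) := by
    rw [← Set.image_smul, Set.image_image]
    refine Set.image_congr fun u hu => ?_
    have hI := hu.2.2
    unfold I at hI
    unfold S
    rw [hn] at hI ⊢
    simp only [smul_eq_mul]
    linarith
  rw [d, hS, Real.sInf_smul_of_nonneg (by norm_num), smul_eq_mul]

end LogNLS

end

namespace LogNLS

open scoped Convolution

/-! The heart is the sharp logarithmic Sobolev inequality: with m = ∫ |u|², one has ∫ |u|² log |u|²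
≤ ∫ |∇u|² + m log m - N (1 + ½ log π) m. Its gradient term has coefficient exactly 1, so subtracting
it from I_ω(u) = 0 cancels the gradient and leaves ω + N + (N/2) log π ≤ log m, which is the claimed
bound. On the constraint set S_ω is half the squared norm, so the bound passes to d(ω), once that
set is known to be nonempty.

On the line the inequality is proved by mass transport (`integral_mul_log_le_of_deriv_sq_le`). Let T
push the density f to a multiple of the Gaussian e^{-t²}, so that T' = c e^{T²} f. Then log f = log
T' - T² - log c, and log T' ≤ T' - 1. Integration by parts turns ∫ f T' into -∫ f' T, which is at
most ∫ h + ∫ f T² when f'² ≤ 4 f h, and the T² terms cancel. With f = |v|² and h = |v'|² this is the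
inequality for v.

The passage to ℝⁿ is tensorization (`integral_mul_log_le_pi`): the inequality on slices produces the
entropy of the marginal, to which the inequality on the line applies. The condition f'² ≤ 4 f h
replaces f'²/f because it makes sense at zeros of f and survives integration over some of the
variables.

Smooth functions give compactly supported H¹ functions by mollification and Fatou's lemma, and these
give the whole energy space by truncation and dominated convergence. -/

/-! ### The inequality on the line, by transport to a Gaussian -/

/-- The inverse of the Gaussian distribution function `x ↦ ∫_{-∞}^x e^{-t²} dt`. -/
theorem exists_gaussian_quantile :
    ∃ Ψ : ℝ → ℝ, ∀ y ∈ Set.Ioo 0 (√Real.pi), HasDerivAt Ψ (Real.exp (Ψ y ^ 2)) y := by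
  have hint : Integrable (fun t : ℝ => Real.exp (-t ^ 2)) := by
    simpa using integrable_exp_neg_mul_sq (b := 1) one_pos
  have hcont : Continuous (fun t : ℝ => Real.exp (-t ^ 2)) := by fun_prop
  set Φ : ℝ → ℝ := fun x => ∫ t in Set.Iic x, Real.exp (-t ^ 2) with hΦ
  have hd : ∀ x, HasDerivAt Φ (Real.exp (-x ^ 2)) x := by
    intro x
    have h1 : Φ = fun u => (∫ t in (0 : ℝ)..u, Real.exp (-t ^ 2)) + Φ 0 := by
      ext u
      have := intervalIntegral.integral_Iic_sub_Iic (f := fun t : ℝ => Real.exp (-t ^ 2))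
        (a := 0) (b := u) hint.integrableOn hint.integrableOn
      simp only [hΦ]
      linarith
    rw [h1]
    exact (intervalIntegral.integral_hasDerivAt_right hint.intervalIntegrable
      hcont.aestronglyMeasurable.stronglyMeasurableAtFilter hcont.continuousAt).add_const _
  have hmono : StrictMono Φ := strictMono_of_deriv_pos fun x => by
    rw [(hd x).deriv]; positivity
  have htop : Filter.Tendsto Φ Filter.atTop (nhds (√Real.pi)) := by
    have h := (aecover_Iic (μ := (volume : Measure ℝ)) Filter.tendsto_id).integral_tendsto_of_countably_generated hint
    have h2 := integral_gaussian 1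
    simp only [neg_mul, one_mul, div_one] at h2
    rw [h2] at h
    exact h
  have hbot : Filter.Tendsto Φ Filter.atBot (nhds 0) := by
    have h := tendsto_setIntegral_of_antitone (μ := (volume : Measure ℝ)) (f := fun t : ℝ => Real.exp (-t ^ 2))
      (s := fun n : ℝ => Set.Iic (-n)) (fun n => measurableSet_Iic)
      (fun a b hab => Set.Iic_subset_Iic.2 (neg_le_neg hab)) ⟨0, hint.integrableOn⟩
    have h2 : (⋂ n : ℝ, Set.Iic (-n)) = (∅ : Set ℝ) := by
      ext x
      simp only [Set.mem_iInter, Set.mem_Iic, Set.mem_empty_iff_false, iff_false, not_forall, not_le]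
      exact ⟨-x + 1, by linarith⟩
    rw [h2] at h
    simp only [setIntegral_empty] at h
    have h3 := h.comp Filter.tendsto_neg_atBot_atTop
    refine h3.congr fun x => ?_
    simp [hΦ]
  have hsurj : ∀ y ∈ Set.Ioo 0 (√Real.pi), ∃ x, Φ x = y := by
    intro y hy
    have hc : Continuous Φ := continuous_iff_continuousAt.2 fun x => (hd x).continuousAt
    exact mem_range_of_exists_le_of_exists_ge hc
      ((hbot.eventually_le_const hy.1).exists) ((htop.eventually_const_le hy.2).exists)
  have hlt : ∀ x, Φ x ∈ Set.Ioo 0 (√Real.pi) := fun x =>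
    ⟨lt_of_le_of_lt (hmono.monotone.le_of_tendsto hbot (x - 1)) (hmono (by linarith)),
      lt_of_lt_of_le (hmono (by linarith : x < x + 1)) (hmono.monotone.ge_of_tendsto htop (x + 1))⟩
  -- Off the interval (0, √π), which is the exact range of `Φ`, this inverse takes a junk value; no
  -- claim is made there.
  refine ⟨Function.invFun Φ, fun y hy => ?_⟩
  have hr : ∀ y ∈ Set.Ioo 0 (√Real.pi), Φ (Function.invFun Φ y) = y := fun y hy =>
    Function.invFun_eq (hsurj y hy)
  have hnhds : Set.Ioo 0 (√Real.pi) ∈ nhds y := isOpen_Ioo.mem_nhds hy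
  -- A strictly increasing function whose image is all of ℝ cannot jump.
  have hcont' : ContinuousAt (Function.invFun Φ) y := by
    refine StrictMonoOn.continuousAt_of_image_mem_nhds (s := Set.Ioo 0 (√Real.pi)) ?_ hnhds ?_
    · intro a ha b hb hab
      rw [← hmono.lt_iff_lt, hr a ha, hr b hb]
      exact hab
    · have : Function.invFun Φ '' Set.Ioo 0 (√Real.pi) = Set.univ := by
        rw [Set.eq_univ_iff_forall]
        exact fun x => ⟨Φ x, hlt x, Function.leftInverse_invFun hmono.injective x⟩
      rw [this]
      exact Filter.univ_mem
  have := HasDerivAt.of_local_left_inverse hcont' (hd _) (Real.exp_pos _).ne'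
    (Filter.eventually_of_mem hnhds hr)
  rwa [← Real.exp_neg, neg_neg] at this

/-- The sharp logarithmic Sobolev inequality on the line for a density `f` whose Fisher information
density `f'² / f` is bounded by `4 h`. -/
theorem integral_mul_log_le_of_deriv_sq_le {f f' h : ℝ → ℝ}
    (hf : Continuous f) (hf' : Continuous f') (hh : Continuous h)
    (hfc : HasCompactSupport f) (hf'c : HasCompactSupport f') (hhc : HasCompactSupport h)
    (h0 : ∀ x, 0 ≤ f x) (hh0 : ∀ x, 0 ≤ h x) (hd : ∀ x, HasDerivAt f (f' x) x)
    (hle : ∀ x, f' x ^ 2 ≤ 4 * f x * h x) :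
    ∫ x, f x * Real.log (f x) ≤
      (∫ x, h x) + (∫ x, f x) * Real.log (∫ x, f x)
        - (1 + Real.log Real.pi / 2) * ∫ x, f x := by
  obtain ⟨Ψ, hΨ⟩ := exists_gaussian_quantile
  have hfi : Integrable f := hf.integrable_of_hasCompactSupport hfc
  set m := ∫ x, f x with hm
  have hm0 : 0 ≤ m := integral_nonneg h0
  have hpi : 0 < √Real.pi := Real.sqrt_pos.2 Real.pi_pos
  set F : ℝ → ℝ := fun x => ∫ t in Set.Iic x, f t with hF
  have hF0 : ∀ x, 0 ≤ F x := fun x => integral_nonneg h0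
  have hFm : ∀ x, F x ≤ m := fun x =>
    setIntegral_le_integral hfi (Filter.Eventually.of_forall h0)
  have hFd : ∀ x, HasDerivAt F (f x) x := by
    intro x
    have h1 : F = fun u => (∫ t in (0 : ℝ)..u, f t) + F 0 := by
      ext u
      have := intervalIntegral.integral_Iic_sub_Iic (f := f)
        (a := 0) (b := u) hfi.integrableOn hfi.integrableOn
      simp only [hF]
      linarith
    rw [h1]
    exact (intervalIntegral.integral_hasDerivAt_right hfi.intervalIntegrable
      hf.aestronglyMeasurable.stronglyMeasurableAtFilter hf.continuousAt).add_const _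
  -- The shift by δ keeps the argument of `Ψ` strictly inside (0, √π) even where `F` equals 0 or m,
  -- so T is finite and differentiable everywhere.
  have main : ∀ δ : ℝ, 0 < δ → ∫ x, f x * Real.log (f x) ≤
      (∫ x, h x) + m * Real.log (m + 2 * δ) - (1 + Real.log Real.pi / 2) * m := by
    intro δ hδ
    have hM : 0 < m + 2 * δ := by linarith
    set c : ℝ := √Real.pi / (m + 2 * δ) with hc
    have hc0 : 0 < c := div_pos hpi hM
    have hlogc : Real.log c = Real.log Real.pi / 2 - Real.log (m + 2 * δ) := by
      rw [hc, Real.log_div hpi.ne' hM.ne', Real.log_sqrt Real.pi_pos.le]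
    set T : ℝ → ℝ := fun x => Ψ (c * (F x + δ)) with hT
    set T' : ℝ → ℝ := fun x => Real.exp (T x ^ 2) * (c * f x) with hT'
    have hmem : ∀ x, c * (F x + δ) ∈ Set.Ioo 0 (√Real.pi) := by
      intro x
      refine ⟨mul_pos hc0 (by linarith [hF0 x]), ?_⟩
      calc c * (F x + δ) < c * (m + 2 * δ) :=
            mul_lt_mul_of_pos_left (by linarith [hFm x]) hc0
        _ = √Real.pi := by rw [hc]; field_simp
    have hTd : ∀ x, HasDerivAt T (T' x) x := fun x =>
      (hΨ _ (hmem x)).comp x (((hFd x).add_const δ).const_mul c)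
    have hTc : Continuous T := continuous_iff_continuousAt.2 fun x => (hTd x).continuousAt
    have hT'c : Continuous T' := by fun_prop
    have ibp : ∫ x, f x * T' x = - ∫ x, f' x * T x :=
      integral_mul_deriv_eq_deriv_mul_of_integrable (fun x _ => hd x) (fun x _ => hTd x)
        ((hf.mul hT'c).integrable_of_hasCompactSupport hfc.mul_right)
        ((hf'.mul hTc).integrable_of_hasCompactSupport hf'c.mul_right)
        ((hf.mul hTc).integrable_of_hasCompactSupport hfc.mul_right)
    -- The last bracket is (f T)', with integral zero by `ibp`; this is where the terms in T²
    -- disappear.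
    have hpt : ∀ x, f x * Real.log (f x) ≤
        (h x + (Real.log (m + 2 * δ) - (1 + Real.log Real.pi / 2)) * f x)
          + (f x * T' x + f' x * T x) := by
      intro x
      -- Arithmetic-geometric mean: |f' T| ≤ 2 √(h · f T²) ≤ h + f T².
      have hq : -(f' x * T x) ≤ h x + f x * T x ^ 2 := by
        have h1 : (f' x * T x) ^ 2 ≤ (h x + f x * T x ^ 2) ^ 2 := by
          have h2 : f' x ^ 2 * T x ^ 2 ≤ (4 * f x * h x) * T x ^ 2 :=
            mul_le_mul_of_nonneg_right (hle x) (sq_nonneg _)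
          nlinarith [sq_nonneg (h x - f x * T x ^ 2)]
        have h3 : 0 ≤ h x + f x * T x ^ 2 :=
          add_nonneg (hh0 x) (mul_nonneg (h0 x) (sq_nonneg _))
        exact (neg_le_abs _).trans (abs_le_of_sq_le_sq h1 h3)
      have hl : f x * Real.log (f x) ≤
          f x * (T' x - 1 - T x ^ 2 - Real.log Real.pi / 2 + Real.log (m + 2 * δ)) := by
        rcases (h0 x).eq_or_lt with hz | hp
        · simp [← hz]
        · refine mul_le_mul_of_nonneg_left ?_ hp.le
          have hT'p : 0 < T' x := by simp only [hT']; positivity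
          have h1 := Real.log_le_sub_one_of_pos hT'p
          have h2 : Real.log (T' x) = T x ^ 2 + (Real.log c + Real.log (f x)) := by
            simp only [hT']
            rw [Real.log_mul (Real.exp_pos _).ne' (by positivity), Real.log_exp,
              Real.log_mul hc0.ne' hp.ne']
          linarith
      linarith
    have i1 : Integrable (fun x => f x * Real.log (f x)) :=
      (Real.continuous_mul_log.comp hf).integrable_of_hasCompactSupport hfc.mul_right
    have i2 : Integrable h := hh.integrable_of_hasCompactSupport hhc
    have i3 : Integrable (fun x => f x * T' x) :=
      (hf.mul hT'c).integrable_of_hasCompactSupport hfc.mul_right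
    have i4 : Integrable (fun x => f' x * T x) :=
      (hf'.mul hTc).integrable_of_hasCompactSupport hf'c.mul_right
    have i5 : Integrable (fun x => (Real.log (m + 2 * δ) - (1 + Real.log Real.pi / 2)) * f x) :=
      hfi.const_mul _
    have i6 : Integrable (fun x => h x +
        (Real.log (m + 2 * δ) - (1 + Real.log Real.pi / 2)) * f x) := i2.add i5
    have i7 : Integrable (fun x => f x * T' x + f' x * T x) := i3.add i4
    have key := integral_mono i1 (i6.add i7) hpt
    simp only [Pi.add_apply] at key
    rw [integral_add i6 i7, integral_add i2 i5, integral_add i3 i4, integral_const_mul, ibp] at key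
    linarith
  have hlim : Filter.Tendsto (fun δ : ℝ => (∫ x, h x) + m * Real.log (m + 2 * δ)
      - (1 + Real.log Real.pi / 2) * m) (nhdsWithin 0 (Set.Ioi 0))
      (nhds ((∫ x, h x) + m * Real.log m - (1 + Real.log Real.pi / 2) * m)) := by
    -- The logarithm is discontinuous at 0, but for m = 0 its coefficient vanishes.
    rcases hm0.eq_or_lt with hz | hp
    · simp [← hz]
    · have hca : ContinuousAt (fun δ : ℝ => (∫ x, h x) + m * Real.log (m + 2 * δ)
          - (1 + Real.log Real.pi / 2) * m) 0 := by
        have : ContinuousAt (fun δ : ℝ => Real.log (m + 2 * δ)) 0 :=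
          ContinuousAt.log (by fun_prop) (by simpa using hp.ne')
        fun_prop
      have := hca.tendsto
      simp only [mul_zero, add_zero] at this
      exact this.mono_left nhdsWithin_le_nhds
  exact ge_of_tendsto hlim (Filter.eventually_of_mem self_mem_nhdsWithin main)

/-! ### Marginals and tensorization -/

/-- A Cauchy-Schwarz inequality: the pointwise quadratic f t² + f' t + h is nonnegative for every t,
hence so is its integral, whose discriminant is therefore nonpositive. It shows that the Fisher
information condition passes to marginals, and it also serves as Jensen's inequality for mollifiers.
-/
theorem sq_integral_le_of_sq_le {α : Type*} [MeasurableSpace α] {μ : Measure α} {f f' h : α → ℝ}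
    (hf : Integrable f μ) (hf' : Integrable f' μ) (hh : Integrable h μ)
    (h0 : ∀ x, 0 ≤ f x) (hh0 : ∀ x, 0 ≤ h x) (hle : ∀ x, f' x ^ 2 ≤ 4 * f x * h x) :
    (∫ x, f' x ∂μ) ^ 2 ≤ 4 * (∫ x, f x ∂μ) * ∫ x, h x ∂μ := by
  have key : ∀ t : ℝ, 0 ≤ (∫ x, f x ∂μ) * (t * t) + (∫ x, f' x ∂μ) * t + ∫ x, h x ∂μ := by
    intro t
    have i1 : Integrable (fun x => f x * (t * t)) μ := hf.mul_const _
    have i2 : Integrable (fun x => f' x * t) μ := hf'.mul_const _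
    have i3 : Integrable (fun x => f x * (t * t) + f' x * t) μ := i1.add i2
    rw [← integral_mul_const, ← integral_mul_const, ← integral_add i1 i2, ← integral_add i3 hh]
    refine integral_nonneg fun x => ?_
    simp only [Pi.zero_apply]
    rcases (h0 x).eq_or_lt with hz | hp
    · have h1 := hle x
      rw [← hz] at h1
      have h2 : f' x = 0 := by nlinarith
      rw [← hz, h2]
      simpa using hh0 x
    · have h1 : 0 ≤ 4 * f x * (f x * (t * t) + f' x * t + h x) := by
        nlinarith [sq_nonneg (2 * f x * t + f' x), hle x]
      exact nonneg_of_mul_nonneg_right h1 (by positivity)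
  have := discrim_le_zero key
  unfold discrim at this
  linarith

section Slices

variable {n : ℕ} {k : (Fin (n + 1) → ℝ) → ℝ}

theorem continuous_finCons :
    Continuous (fun p : ℝ × (Fin n → ℝ) => (Fin.cons p.1 p.2 : Fin (n + 1) → ℝ)) := by
  refine continuous_pi fun i => ?_
  refine Fin.cases ?_ (fun j => ?_) i
  · simpa using continuous_fst
  · simp only [Fin.cons_succ]
    fun_prop

theorem continuous_slice (hk : Continuous k) (y : ℝ) :
    Continuous (fun x : Fin n → ℝ => k (Fin.cons y x)) :=
  hk.comp (continuous_finCons.comp (Continuous.prodMk_right y))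

/-- A slice vanishes off the projection of the support. -/
theorem slice_eq_zero {y : ℝ} {x : Fin n → ℝ} (hx : x ∉ Fin.tail '' tsupport k) :
    k (Fin.cons y x) = 0 := by
  by_contra hne
  exact hx ⟨_, subset_tsupport _ hne, by simp⟩

theorem isCompact_tail_image (hkc : HasCompactSupport k) :
    IsCompact ((Fin.tail : (Fin (n + 1) → ℝ) → (Fin n → ℝ)) '' tsupport k) := by
  refine IsCompact.image hkc ?_
  unfold Fin.tail
  fun_prop

theorem hasCompactSupport_slice (hkc : HasCompactSupport k) (y : ℝ) :
    HasCompactSupport (fun x : Fin n → ℝ => k (Fin.cons y x)) :=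
  HasCompactSupport.intro (isCompact_tail_image hkc) fun _ hx => slice_eq_zero hx

theorem integrable_slice (hk : Continuous k) (hkc : HasCompactSupport k) (y : ℝ) :
    Integrable (fun x : Fin n → ℝ => k (Fin.cons y x)) :=
  (continuous_slice hk y).integrable_of_hasCompactSupport (hasCompactSupport_slice hkc y)

theorem hasCompactSupport_marginal (hkc : HasCompactSupport k) :
    HasCompactSupport (fun y : ℝ => ∫ x : Fin n → ℝ, k (Fin.cons y x)) := by
  refine HasCompactSupport.intro (K := (fun z : Fin (n + 1) → ℝ => z 0) '' tsupport k)
    (IsCompact.image hkc (by fun_prop)) fun y hy => ?_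
  have : ∀ x : Fin n → ℝ, k (Fin.cons y x) = 0 := by
    intro x
    by_contra hne
    exact hy ⟨_, subset_tsupport _ hne, by simp⟩
  simp [this]

theorem continuous_marginal (hk : Continuous k) (hkc : HasCompactSupport k) :
    Continuous (fun y : ℝ => ∫ x : Fin n → ℝ, k (Fin.cons y x)) := by
  have h1 := continuous_parametric_integral_of_continuous (μ := (volume : Measure (Fin n → ℝ)))
    (f := fun (y : ℝ) (x : Fin n → ℝ) => k (Fin.cons y x)) (hk.comp continuous_finCons)
    (isCompact_tail_image hkc)
  convert h1 using 2 with y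
  exact (setIntegral_eq_integral_of_forall_compl_eq_zero fun x hx => slice_eq_zero hx).symm

theorem integral_marginal (hk : Continuous k) (hkc : HasCompactSupport k) :
    ∫ y : ℝ, ∫ x : Fin n → ℝ, k (Fin.cons y x) = ∫ z, k z := by
  have hp := (volume_preserving_piFinSuccAbove (fun _ : Fin (n + 1) => ℝ) 0).symm
  have he : ∀ p : ℝ × (Fin n → ℝ),
      (MeasurableEquiv.piFinSuccAbove (fun _ : Fin (n + 1) => ℝ) 0).symm p = Fin.cons p.1 p.2 := by
    intro p
    simp [MeasurableEquiv.piFinSuccAbove, Fin.insertNthEquiv]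
  have hi : Integrable (fun p : ℝ × (Fin n → ℝ) => k (Fin.cons p.1 p.2)) (volume.prod volume) := by
    have := hp.integrable_comp_of_integrable (hk.integrable_of_hasCompactSupport hkc)
    refine this.congr (Filter.Eventually.of_forall fun p => ?_)
    simp only [Function.comp, he]
  rw [← integral_prod _ hi, ← hp.integral_comp (MeasurableEquiv.measurableEmbedding _)]
  simp only [he]
  rfl

/-- Differentiation under the integral sign: `k'` is bounded and all its slices vanish off one
compact set, so a constant on that set dominates. -/
theorem hasDerivAt_marginal {k' : (Fin (n + 1) → ℝ) → ℝ} (hk : Continuous k)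
    (hkc : HasCompactSupport k) (hk' : Continuous k') (hk'c : HasCompactSupport k')
    (hd : ∀ y x, HasDerivAt (fun t => k (Fin.cons t x)) (k' (Fin.cons y x)) y) (y : ℝ) :
    HasDerivAt (fun y : ℝ => ∫ x : Fin n → ℝ, k (Fin.cons y x))
      (∫ x : Fin n → ℝ, k' (Fin.cons y x)) y := by
  obtain ⟨C, hC⟩ := hk'c.exists_bound_of_continuous hk'
  have hK := isCompact_tail_image hk'c
  refine (hasDerivAt_integral_of_dominated_loc_of_deriv_le (s := Set.univ)
    (bound := ((Fin.tail : (Fin (n + 1) → ℝ) → (Fin n → ℝ)) '' tsupport k').indicator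
      (fun _ => C)) Filter.univ_mem
    (Filter.Eventually.of_forall fun z => (continuous_slice hk z).aestronglyMeasurable)
    (integrable_slice hk hkc y) (F' := fun z x => k' (Fin.cons z x))
    (continuous_slice hk' y).aestronglyMeasurable ?_ ?_ ?_).2
  · refine Filter.Eventually.of_forall fun x z _ => ?_
    by_cases hx : x ∈ (Fin.tail : (Fin (n + 1) → ℝ) → (Fin n → ℝ)) '' tsupport k'
    · rw [Set.indicator_of_mem hx]
      exact hC _
    · rw [Set.indicator_of_notMem hx, slice_eq_zero hx, norm_zero]
  · exact (integrable_indicator_iff hK.measurableSet).2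
      (integrableOn_const hK.measure_lt_top.ne)
  · exact Filter.Eventually.of_forall fun x z _ => hd z x

end Slices

/-- The sharp logarithmic Sobolev inequality on `ℝⁿ`, by tensorization of the inequality on the
line. -/
theorem integral_mul_log_le_pi (n : ℕ) :
    ∀ {f : (Fin n → ℝ) → ℝ} {f' h : Fin n → (Fin n → ℝ) → ℝ},
      Continuous f → (∀ i, Continuous (f' i)) → (∀ i, Continuous (h i)) →
      HasCompactSupport f → (∀ i, HasCompactSupport (f' i)) → (∀ i, HasCompactSupport (h i)) →
      (∀ x, 0 ≤ f x) → (∀ i x, 0 ≤ h i x) →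
      (∀ i x, HasDerivAt (fun t => f (Function.update x i t)) (f' i x) (x i)) →
      (∀ i x, f' i x ^ 2 ≤ 4 * f x * h i x) →
      ∫ x, f x * Real.log (f x) ≤
        (∑ i, ∫ x, h i x) + (∫ x, f x) * Real.log (∫ x, f x)
          - n * (1 + Real.log Real.pi / 2) * ∫ x, f x := by
  induction n with
  | zero =>
    -- The space is one point of mass 1, and both sides equal f log f.
    intro f f' h _ _ _ _ _ _ _ _ _ _
    have hvol : (volume : Measure (Fin 0 → ℝ)).real Set.univ = 1 := by
      simp [Measure.real, volume_pi]
    simp [integral_unique, hvol]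
  | succ n ih =>
    intro f f' h hf hf' hh hfc hf'c hhc h0 hh0 hd hle
    have hflog : Continuous (fun z => f z * Real.log (f z)) := Real.continuous_mul_log.comp hf
    have hflogc : HasCompactSupport (fun z => f z * Real.log (f z)) := hfc.mul_right
    set F : ℝ → ℝ := fun y => ∫ x : Fin n → ℝ, f (Fin.cons y x) with hF
    -- The n-dimensional inequality with the first coordinate frozen; the term F log F it leaves is
    -- bounded after integration in y by `hline`.
    have hslice : ∀ y : ℝ, ∫ x : Fin n → ℝ, f (Fin.cons y x) * Real.log (f (Fin.cons y x)) ≤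
        (∑ i : Fin n, ∫ x : Fin n → ℝ, h i.succ (Fin.cons y x)) + F y * Real.log (F y)
          - n * (1 + Real.log Real.pi / 2) * F y := by
      intro y
      refine ih (f' := fun i x => f' i.succ (Fin.cons y x))
        (h := fun i x => h i.succ (Fin.cons y x)) (continuous_slice hf y)
        (fun i => continuous_slice (hf' _) y) (fun i => continuous_slice (hh _) y)
        (hasCompactSupport_slice hfc y) (fun i => hasCompactSupport_slice (hf'c _) y)
        (fun i => hasCompactSupport_slice (hhc _) y) (fun x => h0 _) (fun i x => hh0 _ _)
        (fun i x => ?_) (fun i x => hle _ _)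
      have := hd i.succ (Fin.cons y x)
      simpa only [Fin.cons_update, Fin.cons_succ] using this
    have hline := integral_mul_log_le_of_deriv_sq_le (f := F)
      (f' := fun y => ∫ x : Fin n → ℝ, f' 0 (Fin.cons y x))
      (h := fun y => ∫ x : Fin n → ℝ, h 0 (Fin.cons y x))
      (continuous_marginal hf hfc) (continuous_marginal (hf' 0) (hf'c 0))
      (continuous_marginal (hh 0) (hhc 0)) (hasCompactSupport_marginal hfc)
      (hasCompactSupport_marginal (hf'c 0)) (hasCompactSupport_marginal (hhc 0))
      (fun y => integral_nonneg fun x => h0 _) (fun y => integral_nonneg fun x => hh0 _ _)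
      (fun y => hasDerivAt_marginal hf hfc (hf' 0) (hf'c 0) (fun y x => by
        have := hd 0 (Fin.cons y x)
        simpa only [Fin.update_cons_zero, Fin.cons_zero] using this) y)
      (fun y => sq_integral_le_of_sq_le (integrable_slice hf hfc y)
        (integrable_slice (hf' 0) (hf'c 0) y) (integrable_slice (hh 0) (hhc 0) y)
        (fun x => h0 _) (fun x => hh0 _ _) (fun x => hle _ _))
    have hFc : Continuous F := continuous_marginal hf hfc
    have hFs : HasCompactSupport F := hasCompactSupport_marginal hfc
    have i1 : Integrable (fun y => ∫ x : Fin n → ℝ,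
        f (Fin.cons y x) * Real.log (f (Fin.cons y x))) :=
      (continuous_marginal hflog hflogc).integrable_of_hasCompactSupport
        (hasCompactSupport_marginal hflogc)
    have i2 : ∀ i : Fin n, Integrable (fun y => ∫ x : Fin n → ℝ, h i.succ (Fin.cons y x)) :=
      fun i => (continuous_marginal (hh _) (hhc _)).integrable_of_hasCompactSupport
        (hasCompactSupport_marginal (hhc _))
    have i2' : Integrable (fun y => ∑ i : Fin n, ∫ x : Fin n → ℝ, h i.succ (Fin.cons y x)) :=
      integrable_finsetSum _ fun i _ => i2 i
    have i3 : Integrable (fun y => F y * Real.log (F y)) :=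
      (Real.continuous_mul_log.comp hFc).integrable_of_hasCompactSupport hFs.mul_right
    have i4 : Integrable (fun y => n * (1 + Real.log Real.pi / 2) * F y) :=
      (hFc.integrable_of_hasCompactSupport hFs).const_mul _
    have i5 : Integrable (fun y => (∑ i : Fin n, ∫ x : Fin n → ℝ, h i.succ (Fin.cons y x))
        + F y * Real.log (F y)) := i2'.add i3
    have key := integral_mono i1 (i5.sub i4) hslice
    simp only [Pi.sub_apply] at key
    rw [integral_sub i5 i4, integral_add i2' i3, integral_finsetSum _ fun i _ => i2 i,
      integral_const_mul, integral_marginal hflog hflogc, integral_marginal hf hfc] at key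
    simp only [integral_marginal (hh _) (hhc _)] at key
    rw [integral_marginal hf hfc, integral_marginal (hh 0) (hhc 0)] at hline
    rw [Fin.sum_univ_succ]
    push_cast
    linarith

/-! ### Smooth functions on Euclidean space -/

/-- The sharp logarithmic Sobolev inequality for compactly supported `C¹` functions. -/
theorem integral_log_le_of_contDiff {N : ℕ} {v : Space N → ℂ} (hv : ContDiff ℝ 1 v)
    (hvc : HasCompactSupport v) :
    ∫ x, ‖v x‖ ^ 2 * Real.log (‖v x‖ ^ 2) ≤
      (∑ i, ∫ x, ‖fderiv ℝ v x (EuclideanSpace.single i 1)‖ ^ 2)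
        + (∫ x, ‖v x‖ ^ 2) * Real.log (∫ x, ‖v x‖ ^ 2)
        - N * (1 + Real.log Real.pi / 2) * ∫ x, ‖v x‖ ^ 2 := by
  have hp := PiLp.volume_preserving_toLp (Fin N)
  have hemb : MeasurableEmbedding (@WithLp.toLp 2 (Fin N → ℝ)) :=
    (MeasurableEquiv.toLp 2 (Fin N → ℝ)).measurableEmbedding
  have ht : Continuous (@WithLp.toLp 2 (Fin N → ℝ)) := PiLp.continuous_toLp 2 _
  have hcl : Topology.IsClosedEmbedding (@WithLp.toLp 2 (Fin N → ℝ)) :=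
    (PiLp.homeomorph 2 (fun _ : Fin N => ℝ)).symm.isClosedEmbedding
  have hDc : ∀ i : Fin N, Continuous (fun x => fderiv ℝ v x (EuclideanSpace.single i 1)) :=
    fun i => (hv.continuous_fderiv one_ne_zero).clm_apply continuous_const
  have hDs : ∀ i : Fin N,
      HasCompactSupport (fun x => fderiv ℝ v x (EuclideanSpace.single i 1)) :=
    fun i => hvc.fderiv_apply ℝ _
  have hvt : HasCompactSupport (fun x => v (WithLp.toLp 2 x)) :=
    hvc.comp_isClosedEmbedding hcl
  -- The density is |v|², with derivative 2 Re⟨v, ∂ᵢv⟩; Cauchy-Schwarz in ℂ gives the Fisher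
  -- condition with h = |∂ᵢv|².
  have key := integral_mul_log_le_pi N
    (f := fun x => ‖v (WithLp.toLp 2 x)‖ ^ 2)
    (f' := fun i x => 2 * inner ℝ (v (WithLp.toLp 2 x))
      (fderiv ℝ v (WithLp.toLp 2 x) (EuclideanSpace.single i 1)))
    (h := fun i x => ‖fderiv ℝ v (WithLp.toLp 2 x) (EuclideanSpace.single i 1)‖ ^ 2)
    ((hv.continuous.comp ht).norm.pow 2)
    (fun i => continuous_const.mul ((hv.continuous.comp ht).inner ((hDc i).comp ht)))
    (fun i => ((hDc i).comp ht).norm.pow 2)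
    (hvt.comp_left (g := fun z : ℂ => ‖z‖ ^ 2) (by simp))
    (fun i => hvt.mono fun x hx => by
      contrapose! hx
      simp only [Function.mem_support, not_not] at hx ⊢
      simp [hx])
    (fun i => ((hDs i).comp_isClosedEmbedding hcl).comp_left (g := fun z : ℂ => ‖z‖ ^ 2) (by simp))
    (fun x => by positivity) (fun i x => by positivity)
    (fun i x => ?_) (fun i x => ?_)
  · simp only [hp.integral_comp hemb (fun y => ‖v y‖ ^ 2 * Real.log (‖v y‖ ^ 2)),
      hp.integral_comp hemb (fun y => ‖v y‖ ^ 2),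
      fun i => hp.integral_comp hemb
        (fun y => ‖fderiv ℝ v y (EuclideanSpace.single i 1)‖ ^ 2)] at key
    exact key
  · have h1 : HasDerivAt (fun t : ℝ => WithLp.toLp 2 (Function.update x i t))
        (EuclideanSpace.single i (1 : ℝ)) (x i) :=
      (PiLp.hasFDerivAt_toLp 2 (Function.update x i (x i))).comp_hasDerivAt (x i) (hasDerivAt_update x i (x i))
    have h2 : HasFDerivAt v (fderiv ℝ v (WithLp.toLp 2 x))
        (WithLp.toLp 2 (Function.update x i (x i))) := by
      rw [Function.update_eq_self]
      exact (hv.differentiable one_ne_zero _).hasFDerivAt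
    have h3 := (h2.comp_hasDerivAt (x i) h1).norm_sq
    simpa only [Function.comp, Function.update_eq_self] using h3
  · have h1 := abs_real_inner_le_norm (v (WithLp.toLp 2 x))
      (fderiv ℝ v (WithLp.toLp 2 x) (EuclideanSpace.single i 1))
    have h2 := sq_le_sq' (abs_le.1 h1).1 (abs_le.1 h1).2
    nlinarith [h2]

/-! ### Mollification of compactly supported functions -/

/-- Fatou's lemma for Bochner integrals of nonnegative functions. -/
theorem integral_le_of_tendsto_ae {α : Type*} [MeasurableSpace α] {μ : Measure α}
    {F : ℕ → α → ℝ} {G : α → ℝ} {a : ℕ → ℝ} {b : ℝ} (hF : ∀ n, Integrable (F n) μ)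
    (hF0 : ∀ n x, 0 ≤ F n x) (hG : Integrable G μ)
    (hlim : ∀ᵐ x ∂μ, Filter.Tendsto (fun n => F n x) Filter.atTop (nhds (G x)))
    (hle : ∀ n, ∫ x, F n x ∂μ ≤ a n) (ha : Filter.Tendsto a Filter.atTop (nhds b)) :
    ∫ x, G x ∂μ ≤ b := by
  have hG0 : 0 ≤ᵐ[μ] G := by
    filter_upwards [hlim] with x hx using ge_of_tendsto' hx fun n => hF0 n x
  have hb : 0 ≤ b := ge_of_tendsto' ha fun n => (integral_nonneg (hF0 n)).trans (hle n)
  rw [← ENNReal.ofReal_le_ofReal_iff hb, ofReal_integral_eq_lintegral_ofReal hG hG0]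
  calc ∫⁻ x, ENNReal.ofReal (G x) ∂μ
      = ∫⁻ x, Filter.liminf (fun n => ENNReal.ofReal (F n x)) Filter.atTop ∂μ := by
        refine lintegral_congr_ae ?_
        filter_upwards [hlim] with x hx
        exact ((ENNReal.continuous_ofReal.tendsto _).comp hx).liminf_eq.symm
    _ ≤ Filter.liminf (fun n => ∫⁻ x, ENNReal.ofReal (F n x) ∂μ) Filter.atTop :=
        lintegral_liminf_le' fun n => (hF n).aemeasurable.ennreal_ofReal
    _ ≤ Filter.liminf (fun n => ENNReal.ofReal (a n)) Filter.atTop := by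
        refine Filter.liminf_le_liminf (Filter.Eventually.of_forall fun n => ?_)
        rw [← ofReal_integral_eq_lintegral_ofReal (hF n)
          (Filter.Eventually.of_forall (hF0 n))]
        exact ENNReal.ofReal_le_ofReal (hle n)
    _ = ENNReal.ofReal b := ((ENNReal.continuous_ofReal.tendsto _).comp ha).liminf_eq

/-- From log s ≥ 1 - 1/s. On a set of finite measure this lower bound lets Fatou's lemma apply to
the entropy, after adding 1. -/
theorem neg_one_le_mul_log {s : ℝ} (hs : 0 ≤ s) : -1 ≤ s * Real.log s := by
  rcases hs.eq_or_lt with h | h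
  · simp [← h]
  · have h1 := mul_le_mul_of_nonneg_left (Real.one_sub_inv_le_log_of_pos h) hs
    rw [mul_sub, mul_one, mul_inv_cancel₀ h.ne'] at h1
    linarith

theorem hasCompactSupport_comp {X E F : Type*} [TopologicalSpace X] [Zero E] [Zero F] {w : X → E}
    {G : E → F} (hwc : HasCompactSupport w) (hG0 : G 0 = 0) :
    HasCompactSupport fun x => G (w x) :=
  hwc.comp_left hG0

theorem integrable_comp_of_hasCompactSupport {N : ℕ} {E : Type*} [TopologicalSpace E] [Zero E]
    {w : Space N → E} {G : E → ℝ} (hw : Continuous w) (hwc : HasCompactSupport w)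
    (hG : Continuous G) (hG0 : G 0 = 0) : Integrable fun x => G (w x) :=
  (hG.comp hw).integrable_of_hasCompactSupport (hasCompactSupport_comp (G := G) hwc hG0)

/-- Radii at most 1 keep all mollified supports in one ball; the bounded ratio of outer to inner
radius is what almost everywhere convergence of the mollifications requires. -/
theorem exists_bump_sequence (N : ℕ) :
    ∃ φ : ℕ → ContDiffBump (0 : Space N), (∀ n, (φ n).rOut ≤ 1) ∧
      Filter.Tendsto (fun n => (φ n).rOut) Filter.atTop (nhds 0) ∧
      ∀ n, (φ n).rOut ≤ 2 * (φ n).rIn := by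
  refine ⟨fun n => ⟨1 / ((n : ℝ) + 2), 2 * (1 / ((n : ℝ) + 2)), by positivity, by
      have : (0 : ℝ) < 1 / ((n : ℝ) + 2) := by positivity
      linarith⟩, fun n => ?_, ?_, fun n => le_rfl⟩
  · change 2 * (1 / ((n : ℝ) + 2)) ≤ 1
    rw [mul_one_div, div_le_one (by positivity)]
    have : (0 : ℝ) ≤ n := n.cast_nonneg
    linarith
  · have h1 : Filter.Tendsto (fun n : ℕ => (n : ℝ) + 2) Filter.atTop Filter.atTop :=
      Filter.tendsto_atTop_add_const_right _ _ tendsto_natCast_atTop_atTop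
    have h2 := (h1.inv_tendsto_atTop).const_mul 2
    simpa using h2

section Mollification

variable {N : ℕ} (φ : ContDiffBump (0 : Space N))

theorem convolutionExists_normed {E : Type*} [NormedAddCommGroup E] [NormedSpace ℝ E]
    {w : Space N → E} (hw : LocallyIntegrable w) :
    ConvolutionExists (φ.normed volume) w (ContinuousLinearMap.lsmul ℝ ℝ) volume :=
  HasCompactSupport.convolutionExists_left _ φ.hasCompactSupport_normed φ.continuous_normed hw

/-- Jensen's inequality for the probability density `φ.normed volume`, obtained with f = φ, f' = 2 φ
|w| and h = φ |w|². -/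
theorem norm_sq_convolution_le {w : Space N → ℂ} (hw : MemLp w 2) (x : Space N) :
    ‖(φ.normed volume ⋆[ContinuousLinearMap.lsmul ℝ ℝ] w) x‖ ^ 2 ≤
      (φ.normed volume ⋆[ContinuousLinearMap.lsmul ℝ ℝ] fun y => ‖w y‖ ^ 2) x := by
  have hsq : Integrable (fun y => ‖w y‖ ^ 2) := hw.integrable_norm_pow two_ne_zero
  have e1 : Integrable fun t => φ.normed volume t * ‖w (x - t)‖ := by
    have := (convolutionExists_normed φ (hw.locallyIntegrable (by norm_num)) x).norm
    refine this.congr (Filter.Eventually.of_forall fun t => ?_)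
    simp [abs_of_nonneg (φ.nonneg_normed t)]
  have e2 : Integrable fun t => φ.normed volume t * ‖w (x - t)‖ ^ 2 :=
    convolutionExists_normed φ hsq.locallyIntegrable x
  have key := sq_integral_le_of_sq_le (f := φ.normed volume)
    (f' := fun t => 2 * (φ.normed volume t * ‖w (x - t)‖)) φ.integrable_normed
    (e1.const_mul 2) e2 (fun t => φ.nonneg_normed t)
    (fun t => mul_nonneg (φ.nonneg_normed t) (sq_nonneg _)) (fun t => le_of_eq (by ring))
  rw [integral_const_mul, φ.integral_normed] at key
  have hn : ‖(φ.normed volume ⋆[ContinuousLinearMap.lsmul ℝ ℝ] w) x‖ ≤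
      ∫ t, φ.normed volume t * ‖w (x - t)‖ := by
    refine (norm_integral_le_integral_norm _).trans_eq (integral_congr_ae ?_)
    refine Filter.Eventually.of_forall fun t => ?_
    simp [abs_of_nonneg (φ.nonneg_normed t)]
  have h2 := pow_le_pow_left₀ (norm_nonneg _) hn 2
  refine h2.trans ?_
  simp only [convolution_def, ContinuousLinearMap.lsmul_apply, smul_eq_mul]
  linarith

theorem integral_norm_sq_convolution_le {w : Space N → ℂ} (hw : MemLp w 2) :
    ∫ x, ‖(φ.normed volume ⋆[ContinuousLinearMap.lsmul ℝ ℝ] w) x‖ ^ 2 ≤ ∫ x, ‖w x‖ ^ 2 := by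
  have hsq : Integrable (fun y => ‖w y‖ ^ 2) := hw.integrable_norm_pow two_ne_zero
  calc _ ≤ ∫ x, (φ.normed volume ⋆[ContinuousLinearMap.lsmul ℝ ℝ] fun y => ‖w y‖ ^ 2) x :=
        integral_mono_of_nonneg (Filter.Eventually.of_forall fun x => by positivity)
          (φ.integrable_normed.integrable_convolution _ hsq)
          (Filter.Eventually.of_forall (norm_sq_convolution_le φ hw))
    _ = ∫ x, ‖w x‖ ^ 2 := by
        rw [integral_convolution _ φ.integrable_normed hsq, φ.integral_normed]
        simp

/-- The derivative falls on the kernel, and y ↦ φ(x - y) is an admissible test function. The sign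
produced by the reflection cancels the sign of the weak formulation. -/
theorem fderiv_convolution_apply {v g : Space N → ℂ} (hv : LocallyIntegrable v) {e : Space N}
    (hw : ∀ ψ : Space N → ℝ, ContDiff ℝ (⊤ : ℕ∞) ψ → HasCompactSupport ψ →
      ∫ x, (fderiv ℝ ψ x e) • v x = - ∫ x, ψ x • g x) (x : Space N) :
    fderiv ℝ (φ.normed volume ⋆[ContinuousLinearMap.lsmul ℝ ℝ] v) x e =
      (φ.normed volume ⋆[ContinuousLinearMap.lsmul ℝ ℝ] g) x := by
  have hφ1 : ContDiff ℝ 1 (φ.normed volume) := φ.contDiff_normed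
  rw [(φ.hasCompactSupport_normed.hasFDerivAt_convolution_left
    (ContinuousLinearMap.lsmul ℝ ℝ) hφ1 hv x).fderiv]
  have hi : Integrable fun t => ((ContinuousLinearMap.lsmul ℝ ℝ : ℝ →L[ℝ] ℂ →L[ℝ] ℂ).precompL
      (Space N)) (fderiv ℝ (φ.normed volume) t) (v (x - t)) :=
    (φ.hasCompactSupport_normed.fderiv ℝ).convolutionExists_left _
      (hφ1.continuous_fderiv one_ne_zero) hv x
  rw [convolution_def, ContinuousLinearMap.integral_apply hi]
  simp only [ContinuousLinearMap.precompL_apply, ContinuousLinearMap.lsmul_apply]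
  rw [convolution_def,
    ← integral_sub_left_eq_self (fun t => fderiv ℝ (φ.normed volume) t e • v (x - t)) volume x,
    ← integral_sub_left_eq_self (fun t => ContinuousLinearMap.lsmul ℝ ℝ (φ.normed volume t)
      (g (x - t))) volume x]
  simp only [sub_sub_cancel, ContinuousLinearMap.lsmul_apply]
  have h1 := hw (fun y => φ.normed volume (x - y))
    (φ.contDiff_normed.comp (contDiff_const.sub contDiff_id))
    (φ.hasCompactSupport_normed.comp_homeomorph (Homeomorph.subLeft x))
  have h2 : ∀ y, fderiv ℝ (fun y => φ.normed volume (x - y)) y e =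
      - fderiv ℝ (φ.normed volume) (x - y) e := by
    intro y
    have h3 := ((hφ1.differentiable one_ne_zero (x - y)).hasFDerivAt).comp y
      ((hasFDerivAt_id y).const_sub x)
    have h4 := h3.fderiv
    simp only [Function.comp_def] at h4
    rw [h4]
    simp
  simp only [h2, neg_smul, integral_neg, neg_inj] at h1
  exact h1

end Mollification

/-- The sharp logarithmic Sobolev inequality for compactly supported `H¹` functions. -/
theorem integral_log_le_of_hasCompactSupport {N : ℕ} {v : Space N → ℂ}
    {g : Fin N → Space N → ℂ} (hv : MemLp v 2) (hg : ∀ i, MemLp (g i) 2)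
    (hw : ∀ ψ : Space N → ℝ, ContDiff ℝ (⊤ : ℕ∞) ψ → HasCompactSupport ψ → ∀ i,
      ∫ x, (fderiv ℝ ψ x (EuclideanSpace.single i 1)) • v x = - ∫ x, ψ x • g i x)
    (hvc : HasCompactSupport v)
    (hlog : Integrable fun x => ‖v x‖ ^ 2 * Real.log (‖v x‖ ^ 2)) :
    ∫ x, ‖v x‖ ^ 2 * Real.log (‖v x‖ ^ 2) ≤
      (∑ i, ∫ x, ‖g i x‖ ^ 2) + (∫ x, ‖v x‖ ^ 2) * Real.log (∫ x, ‖v x‖ ^ 2)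
        - N * (1 + Real.log Real.pi / 2) * ∫ x, ‖v x‖ ^ 2 := by
  have hvl : LocallyIntegrable v := hv.locallyIntegrable (by norm_num)
  have hvsq : Integrable (fun y => ‖v y‖ ^ 2) := hv.integrable_norm_pow two_ne_zero
  obtain ⟨R, hR⟩ := hvc.isCompact.isBounded.subset_closedBall (0 : Space N)
  obtain ⟨φ, hφ1, hφ0, hφ2⟩ := exists_bump_sequence N
  obtain ⟨V, hV⟩ : ∃ V : ℕ → Space N → ℂ, ∀ n, V n =
      (φ n).normed volume ⋆[ContinuousLinearMap.lsmul ℝ ℝ] v := ⟨_, fun _ => rfl⟩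
  have hVlim : ∀ᵐ x, Filter.Tendsto (fun n => V n x) Filter.atTop (nhds (v x)) := by
    simp only [hV]
    exact ContDiffBump.ae_convolution_tendsto_right_of_locallyIntegrable (K := 2) hφ0
      (Filter.Eventually.of_forall hφ2) hvl
  have hVd : ∀ n, ContDiff ℝ 1 (V n) := fun n => by
    rw [hV]
    exact (φ n).hasCompactSupport_normed.contDiff_convolution_left (n := 1) _
      (φ n).contDiff_normed hvl
  have hVc : ∀ n, HasCompactSupport (V n) := fun n => by
    rw [hV]
    exact HasCompactSupport.convolution _ (φ n).hasCompactSupport_normed hvc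
  set B : Set (Space N) := Metric.closedBall 0 (R + 1) with hB
  have hV0 : ∀ n, ∀ x ∉ B, V n x = 0 := by
    intro n x hx
    by_contra hne
    rw [hV] at hne
    obtain ⟨a, ha, b, hb, rfl⟩ := support_convolution_subset _ hne
    refine hx ?_
    have ha' : ‖a‖ < (φ n).rOut := by
      have : a ∈ Function.support ((φ n).normed volume) := ha
      rw [ContDiffBump.support_normed_eq] at this
      simpa using this
    have hb' : ‖b‖ ≤ R := by simpa using hR (subset_tsupport _ hb)
    simp only [hB, mem_closedBall_zero_iff]
    linarith [norm_add_le a b, hφ1 n]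
  obtain ⟨M, hM⟩ : ∃ M : ℝ, M = ∫ x, ‖v x‖ ^ 2 := ⟨_, rfl⟩
  have hMn : ∀ n, (∫ x, ‖V n x‖ ^ 2) ∈ Set.Icc 0 M := fun n =>
    ⟨integral_nonneg fun x => by positivity, by
      rw [hM, hV]
      exact integral_norm_sq_convolution_le (φ n) hv⟩
  -- Convergence of the masses is obtained without strong L² convergence: they lie in [0, M], a
  -- subsequence converges, and Fatou's lemma forbids a limit below M.
  obtain ⟨M', hM', s, hs, hslim⟩ := isCompact_Icc.tendsto_subseq hMn
  have hlims : ∀ᵐ x, Filter.Tendsto (fun n => V (s n) x) Filter.atTop (nhds (v x)) := by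
    filter_upwards [hVlim] with x hx using hx.comp hs.tendsto_atTop
  have hVi : ∀ n, Integrable fun x => ‖V n x‖ ^ 2 := fun n =>
    integrable_comp_of_hasCompactSupport (G := fun z => ‖z‖ ^ 2) (hVd n).continuous (hVc n)
      (continuous_norm.pow 2) (by simp)
  have hMM : M' = M := by
    refine le_antisymm hM'.2 (hM ▸ integral_le_of_tendsto_ae (fun n => hVi (s n))
      (fun n x => by positivity) hvsq ?_ (fun n => le_rfl) hslim)
    filter_upwards [hlims] with x hx using hx.norm.pow 2
  rw [hMM] at hslim
  rw [← hM]
  have hVlog : ∀ n, Integrable fun x => ‖V n x‖ ^ 2 * Real.log (‖V n x‖ ^ 2) := fun n =>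
    integrable_comp_of_hasCompactSupport (G := fun z => ‖z‖ ^ 2 * Real.log (‖z‖ ^ 2))
      (hVd n).continuous (hVc n) (Real.continuous_mul_log.comp (continuous_norm.pow 2)) (by simp)
  have hBi : Integrable (B.indicator fun _ => (1 : ℝ)) :=
    (integrable_indicator_iff measurableSet_closedBall).2
      (integrableOn_const measure_closedBall_lt_top.ne)
  -- Adding the indicator of `B` makes the entropy densities nonnegative: they are at least -1 on
  -- `B` and vanish outside it. Its integral cancels at the end.
  have hfatou := integral_le_of_tendsto_ae
    (F := fun n x => ‖V (s n) x‖ ^ 2 * Real.log (‖V (s n) x‖ ^ 2) + B.indicator (fun _ => 1) x)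
    (G := fun x => ‖v x‖ ^ 2 * Real.log (‖v x‖ ^ 2) + B.indicator (fun _ => 1) x)
    (a := fun n => ((∑ i, ∫ x, ‖g i x‖ ^ 2)
        + (∫ x, ‖V (s n) x‖ ^ 2) * Real.log (∫ x, ‖V (s n) x‖ ^ 2)
        - N * (1 + Real.log Real.pi / 2) * ∫ x, ‖V (s n) x‖ ^ 2)
        + ∫ x, B.indicator (fun _ => (1 : ℝ)) x)
    (b := ((∑ i, ∫ x, ‖g i x‖ ^ 2) + M * Real.log M - N * (1 + Real.log Real.pi / 2) * M)
        + ∫ x, B.indicator (fun _ => (1 : ℝ)) x)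
    (fun n => (hVlog (s n)).add hBi) ?_ (hlog.add hBi) ?_ ?_ ?_
  · rw [integral_add hlog hBi] at hfatou
    linarith
  · intro n x
    by_cases hx : x ∈ B
    · rw [Set.indicator_of_mem hx]
      linarith [neg_one_le_mul_log (sq_nonneg ‖V (s n) x‖)]
    · simp [hx, hV0 (s n) x hx]
  · filter_upwards [hlims] with x hx
    exact ((Real.continuous_mul_log.tendsto _).comp (hx.norm.pow 2)).add_const _
  · intro n
    rw [integral_add (hVlog (s n)) hBi]
    refine add_le_add_left ((integral_log_le_of_contDiff (hVd (s n)) (hVc (s n))).trans ?_) _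
    -- The gradient of the mollification is the mollified gradient, and mollification contracts the
    -- L² norm.
    have : ∑ i, ∫ x, ‖fderiv ℝ (V (s n)) x (EuclideanSpace.single i 1)‖ ^ 2 ≤
        ∑ i, ∫ x, ‖g i x‖ ^ 2 := by
      refine Finset.sum_le_sum fun i _ => ?_
      simp only [hV (s n), fderiv_convolution_apply _ hvl fun ψ h1 h2 => hw ψ h1 h2 i]
      exact integral_norm_sq_convolution_le _ (hg i)
    linarith
  · exact ((((Real.continuous_mul_log.tendsto _).comp hslim).const_add _).sub
      (hslim.const_mul _)).add_const _

/-! ### Truncation to compact support -/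

/-- Test the weak derivative of `u` against ψχ and apply the classical product rule to that test
function. -/
theorem integral_weak_product_rule {N : ℕ} {u g : Space N → ℂ} {χ : Space N → ℝ} {e : Space N}
    (hu : LocallyIntegrable u) (hg : LocallyIntegrable g)
    (hw : ∀ ψ : Space N → ℝ, ContDiff ℝ (⊤ : ℕ∞) ψ → HasCompactSupport ψ →
      ∫ x, (fderiv ℝ ψ x e) • u x = - ∫ x, ψ x • g x)
    (hχ : ContDiff ℝ (⊤ : ℕ∞) χ) {ψ : Space N → ℝ} (hψ : ContDiff ℝ (⊤ : ℕ∞) ψ)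
    (hψc : HasCompactSupport ψ) :
    ∫ x, (fderiv ℝ ψ x e) • (χ x • u x) =
      - ∫ x, ψ x • (χ x • g x + fderiv ℝ χ x e • u x) := by
  have h1 := hw (fun x => ψ x * χ x) (hψ.mul hχ) hψc.mul_right
  have hd : ∀ x, fderiv ℝ (fun x => ψ x * χ x) x e =
      ψ x * fderiv ℝ χ x e + χ x * fderiv ℝ ψ x e := by
    intro x
    rw [fderiv_fun_mul (hψ.differentiable (by simp) x) (hχ.differentiable (by simp) x)]
    simp
  have cψ' : Continuous fun x => fderiv ℝ ψ x e :=
    (hψ.continuous_fderiv (by simp)).clm_apply continuous_const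
  have cχ' : Continuous fun x => fderiv ℝ χ x e :=
    (hχ.continuous_fderiv (by simp)).clm_apply continuous_const
  have sψ' : HasCompactSupport fun x => fderiv ℝ ψ x e := hψc.fderiv_apply ℝ e
  have i1 : Integrable fun x => (ψ x * fderiv ℝ χ x e) • u x :=
    hu.integrable_smul_left_of_hasCompactSupport (hψ.continuous.mul cχ') hψc.mul_right
  have i2 : Integrable fun x => (χ x * fderiv ℝ ψ x e) • u x :=
    hu.integrable_smul_left_of_hasCompactSupport (hχ.continuous.mul cψ') sψ'.mul_left
  have i3 : Integrable fun x => (ψ x * χ x) • g x :=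
    hg.integrable_smul_left_of_hasCompactSupport (hψ.continuous.mul hχ.continuous) hψc.mul_right
  simp only [hd, add_smul] at h1
  rw [integral_add i1 i2] at h1
  simp only [smul_add, smul_smul]
  rw [integral_add i3 i1, neg_add, ← h1]
  simp only [mul_comm (fderiv ℝ ψ _ e)]
  abel

theorem abs_mul_log_le_one {t : ℝ} (h0 : 0 ≤ t) (h1 : t ≤ 1) : |t * Real.log t| ≤ 1 :=
  abs_le.2 ⟨neg_one_le_mul_log h0,
    (mul_nonpos_of_nonneg_of_nonpos h0 (Real.log_nonpos h0 h1)).trans zero_le_one⟩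

/-- Split log(ts) = log t + log s and use |t log t| ≤ 1 on [0, 1]. The bound does not depend on t,
so it dominates the entropies of all truncations at once. -/
theorem abs_mul_mul_log_le {t s : ℝ} (h0 : 0 ≤ t) (h1 : t ≤ 1) (hs : 0 ≤ s) :
    |t * s * Real.log (t * s)| ≤ |s * Real.log s| + s := by
  rcases h0.eq_or_lt with h | ht
  · rw [← h]; simp; positivity
  rcases hs.eq_or_lt with h | hs'
  · rw [← h]; simp
  rw [Real.log_mul ht.ne' hs'.ne']
  calc |t * s * (Real.log t + Real.log s)|
      = |t * (s * Real.log s) + (t * Real.log t) * s| := by ring_nf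
    _ ≤ |t * (s * Real.log s)| + |(t * Real.log t) * s| := abs_add_le _ _
    _ ≤ |s * Real.log s| + s := by
        rw [abs_mul, abs_mul (t * Real.log t), abs_of_pos ht, abs_of_pos hs']
        have := abs_mul_log_le_one h0 h1
        gcongr
        · exact mul_le_of_le_one_left (abs_nonneg _) h1
        · exact mul_le_of_le_one_left hs this

/-- The sharp logarithmic Sobolev inequality in `H¹(ℝ^N)`, for functions of finite entropy. -/
theorem integral_log_le_of_isWeakGradient {N : ℕ} {u : Space N → ℂ}
    {g : Fin N → Space N → ℂ} (hu : MemLp u 2) (hg : ∀ i, MemLp (g i) 2)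
    (hw : ∀ ψ : Space N → ℝ, ContDiff ℝ (⊤ : ℕ∞) ψ → HasCompactSupport ψ → ∀ i,
      ∫ x, (fderiv ℝ ψ x (EuclideanSpace.single i 1)) • u x = - ∫ x, ψ x • g i x)
    (hlog : Integrable fun x => ‖u x‖ ^ 2 * Real.log (‖u x‖ ^ 2)) :
    ∫ x, ‖u x‖ ^ 2 * Real.log (‖u x‖ ^ 2) ≤
      (∑ i, ∫ x, ‖g i x‖ ^ 2) + (∫ x, ‖u x‖ ^ 2) * Real.log (∫ x, ‖u x‖ ^ 2)
        - N * (1 + Real.log Real.pi / 2) * ∫ x, ‖u x‖ ^ 2 := by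
  have hul : LocallyIntegrable u := hu.locallyIntegrable (by norm_num)
  have husq : Integrable (fun y => ‖u y‖ ^ 2) := hu.integrable_norm_pow two_ne_zero
  have hgsq : ∀ i, Integrable (fun y => ‖g i y‖ ^ 2) := fun i =>
    (hg i).integrable_norm_pow two_ne_zero
  obtain ⟨b⟩ : Nonempty (ContDiffBump (0 : Space N)) := ⟨⟨1, 2, one_pos, one_lt_two⟩⟩
  have hb : ContDiff ℝ (⊤ : ℕ∞) b := b.contDiff
  have hbc : HasCompactSupport b := b.hasCompactSupport
  have hb' : ∀ i, Continuous fun x => fderiv ℝ b x (EuclideanSpace.single i 1) := fun i =>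
    (hb.continuous_fderiv (by simp)).clm_apply continuous_const
  obtain ⟨C, hC⟩ : ∃ C : ℝ, ∀ (i : Fin N) x, ‖fderiv ℝ b x (EuclideanSpace.single i 1)‖ ≤ C := by
    obtain ⟨C, hC⟩ := (hbc.fderiv ℝ).exists_bound_of_continuous (hb.continuous_fderiv (by simp))
    refine ⟨C, fun i x => ((fderiv ℝ b x).le_opNorm _).trans ?_⟩
    simpa using hC x
  obtain ⟨c, hc⟩ : ∃ c : ℕ → ℝ, ∀ n, c n = 1 / ((n : ℝ) + 1) := ⟨_, fun _ => rfl⟩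
  have hc0 : ∀ n, 0 < c n := fun n => by rw [hc]; positivity
  have hc1 : ∀ n, c n ≤ 1 := fun n => by
    rw [hc, div_le_one (by positivity)]
    linarith [(n.cast_nonneg : (0 : ℝ) ≤ n)]
  have hclim : Filter.Tendsto c Filter.atTop (nhds 0) := by
    simpa only [← funext hc] using tendsto_one_div_add_atTop_nhds_zero_nat (𝕜 := ℝ)
  have hcx : ∀ x : Space N, Filter.Tendsto (fun n => c n • x) Filter.atTop (nhds 0) := fun x => by
    simpa using hclim.smul_const x
  -- Cutoffs obtained by dilating one bump by n + 1: they tend to 1 pointwise, while their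
  -- derivatives carry the factor `c n` and tend to 0, staying bounded by `C`.
  obtain ⟨χ, hχ⟩ : ∃ χ : ℕ → Space N → ℝ, ∀ n x, χ n x = b (c n • x) := ⟨_, fun _ _ => rfl⟩
  obtain ⟨χ', hχ'⟩ : ∃ χ' : ℕ → Fin N → Space N → ℝ, ∀ n i x,
      χ' n i x = c n * fderiv ℝ b (c n • x) (EuclideanSpace.single i 1) := ⟨_, fun _ _ _ => rfl⟩
  have hχs : ∀ n, ContDiff ℝ (⊤ : ℕ∞) (χ n) := fun n => by
    rw [funext (hχ n)]
    exact hb.comp (contDiff_const_smul _)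
  have hχc : ∀ n, HasCompactSupport (χ n) := fun n => by
    rw [funext (hχ n)]
    exact hbc.comp_smul (hc0 n).ne'
  have hχd : ∀ n i x, fderiv ℝ (χ n) x (EuclideanSpace.single i 1) = χ' n i x := fun n i x => by
    have h1 := ((hb.differentiable (by simp) (c n • x)).hasFDerivAt).comp x
      ((hasFDerivAt_id x).const_smul (c n))
    rw [hχ', funext (hχ n)]
    have h2 := h1.fderiv
    simp only [Function.comp_def] at h2
    rw [h2]
    simp
  have hχ0 : ∀ n x, 0 ≤ χ n x := fun n x => by rw [hχ]; exact b.nonneg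
  have hχ1 : ∀ n x, χ n x ≤ 1 := fun n x => by rw [hχ]; exact b.le_one
  have hχC : ∀ n i x, |χ' n i x| ≤ C := fun n i x => by
    rw [hχ', abs_mul, abs_of_pos (hc0 n)]
    exact (mul_le_of_le_one_left (abs_nonneg _) (hc1 n)).trans (hC i _)
  have hχlim : ∀ x, Filter.Tendsto (fun n => χ n x) Filter.atTop (nhds 1) := fun x => by
    simp only [hχ]
    have h1 := (b.continuous.tendsto 0).comp (hcx x)
    rwa [b.one_of_mem_closedBall (by simp [b.rIn_pos.le])] at h1
  have hχ'lim : ∀ i x, Filter.Tendsto (fun n => χ' n i x) Filter.atTop (nhds 0) := fun i x => by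
    simp only [hχ']
    simpa using hclim.mul (((hb' i).tendsto 0).comp (hcx x))
  have hχ'c : ∀ n i, Continuous (χ' n i) := fun n i => by
    rw [funext (hχ' n i)]
    exact continuous_const.mul ((hb' i).comp (continuous_const_smul _))
  have hn : ∀ n x, ‖χ n x • u x‖ ^ 2 = χ n x ^ 2 * ‖u x‖ ^ 2 := fun n x => by
    rw [norm_smul, mul_pow, Real.norm_eq_abs, sq_abs]
  have hsq1 : ∀ n x, χ n x ^ 2 ≤ 1 := fun n x => pow_le_one₀ (hχ0 n x) (hχ1 n x)
  have mu : ∀ n, AEStronglyMeasurable (fun x => χ n x • u x) := fun n =>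
    (hχs n).continuous.aestronglyMeasurable.smul hu.1
  have mv : ∀ n, MemLp (fun x => χ n x • u x) 2 := fun n =>
    hu.of_le (mu n) (Filter.Eventually.of_forall fun x => by
      rw [norm_smul, Real.norm_of_nonneg (hχ0 n x)]
      exact mul_le_of_le_one_left (norm_nonneg _) (hχ1 n x))
  have mg : ∀ n i, MemLp (fun x => χ n x • g i x + χ' n i x • u x) 2 := fun n i => by
    refine MemLp.add ((hg i).of_le ((hχs n).continuous.aestronglyMeasurable.smul (hg i).1)
      (Filter.Eventually.of_forall fun x => ?_)) (hu.of_le_mul (c := C)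
      ((hχ'c n i).aestronglyMeasurable.smul hu.1) (Filter.Eventually.of_forall fun x => ?_))
    · rw [norm_smul, Real.norm_of_nonneg (hχ0 n x)]
      exact mul_le_of_le_one_left (norm_nonneg _) (hχ1 n x)
    · rw [norm_smul]
      exact mul_le_mul_of_nonneg_right (hχC n i x) (norm_nonneg _)
  have mlog : ∀ n, AEStronglyMeasurable
      (fun x => ‖χ n x • u x‖ ^ 2 * Real.log (‖χ n x • u x‖ ^ 2)) := fun n =>
    Real.continuous_mul_log.comp_aestronglyMeasurable ((mu n).norm.pow 2)
  have ilog : Integrable fun x => |‖u x‖ ^ 2 * Real.log (‖u x‖ ^ 2)| + ‖u x‖ ^ 2 :=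
    hlog.abs.add husq
  have blog : ∀ n x, ‖‖χ n x • u x‖ ^ 2 * Real.log (‖χ n x • u x‖ ^ 2)‖ ≤
      |‖u x‖ ^ 2 * Real.log (‖u x‖ ^ 2)| + ‖u x‖ ^ 2 := fun n x => by
    rw [hn]
    exact abs_mul_mul_log_le (sq_nonneg _) (hsq1 n x) (sq_nonneg _)
  have key : ∀ n, _ := fun n => integral_log_le_of_hasCompactSupport (mv n) (mg n)
    (fun ψ h1 h2 i => by
      simp only [← hχd]
      exact integral_weak_product_rule hul ((hg i).locallyIntegrable (by norm_num))
        (fun ψ h1 h2 => hw ψ h1 h2 i) (hχs n) h1 h2)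
    (hχc n).smul_right (ilog.mono' (mlog n) (Filter.Eventually.of_forall (blog n)))
  have hvlim : ∀ x, Filter.Tendsto (fun n => ‖χ n x • u x‖ ^ 2) Filter.atTop
      (nhds (‖u x‖ ^ 2)) := fun x => by
    simpa using (((hχlim x).smul_const (u x)).norm).pow 2
  have lim1 : Filter.Tendsto
      (fun n => ∫ x, ‖χ n x • u x‖ ^ 2 * Real.log (‖χ n x • u x‖ ^ 2)) Filter.atTop
      (nhds (∫ x, ‖u x‖ ^ 2 * Real.log (‖u x‖ ^ 2))) :=
    tendsto_integral_of_dominated_convergence _ mlog ilog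
      (fun n => Filter.Eventually.of_forall (blog n))
      (Filter.Eventually.of_forall fun x =>
        (Real.continuous_mul_log.tendsto _).comp (hvlim x))
  have lim2 : Filter.Tendsto (fun n => ∫ x, ‖χ n x • u x‖ ^ 2) Filter.atTop
      (nhds (∫ x, ‖u x‖ ^ 2)) :=
    tendsto_integral_of_dominated_convergence _ (fun n => (mu n).norm.pow 2) husq
      (fun n => Filter.Eventually.of_forall fun x => by
        rw [Real.norm_of_nonneg (by positivity), hn]
        exact mul_le_of_le_one_left (sq_nonneg _) (hsq1 n x))
      (Filter.Eventually.of_forall hvlim)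
  have lim3 : ∀ i, Filter.Tendsto (fun n => ∫ x, ‖χ n x • g i x + χ' n i x • u x‖ ^ 2)
      Filter.atTop (nhds (∫ x, ‖g i x‖ ^ 2)) := fun i =>
    tendsto_integral_of_dominated_convergence
      -- The dominating function comes from (a + b)² ≤ 2a² + 2b² with a = |gᵢ| and b = C |u|.
      (fun x => 2 * ‖g i x‖ ^ 2 + 2 * C ^ 2 * ‖u x‖ ^ 2) (fun n => (mg n i).1.norm.pow 2)
      (((hgsq i).const_mul _).add (husq.const_mul _))
      (fun n => Filter.Eventually.of_forall fun x => by
        rw [Real.norm_of_nonneg (by positivity)]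
        have h1 : ‖χ n x • g i x + χ' n i x • u x‖ ≤ ‖g i x‖ + C * ‖u x‖ := by
          refine (norm_add_le _ _).trans (add_le_add ?_ ?_)
          · rw [norm_smul, Real.norm_of_nonneg (hχ0 n x)]
            exact mul_le_of_le_one_left (norm_nonneg _) (hχ1 n x)
          · rw [norm_smul]
            exact mul_le_mul_of_nonneg_right (hχC n i x) (norm_nonneg _)
        have h2 := pow_le_pow_left₀ (norm_nonneg _) h1 2
        nlinarith [sq_nonneg (‖g i x‖ - C * ‖u x‖)])
      (Filter.Eventually.of_forall fun x => by
        simpa using ((((hχlim x).smul_const (g i x)).add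
          ((hχ'lim i x).smul_const (u x))).norm).pow 2)
  exact le_of_tendsto_of_tendsto' lim1
    (((tendsto_finsetSum _ fun i _ => lim3 i).add
      ((Real.continuous_mul_log.tendsto _).comp lim2)).sub (lim2.const_mul _)) key

/-! ### The energy space and the bound on the Nehari manifold -/

theorem integral_norm_sq_eq {N : ℕ} (u : L2 N) : ∫ x, ‖u x‖ ^ 2 = ‖u‖ ^ 2 := by
  have h := L2.inner_def (𝕜 := ℂ) u u
  simp only [inner_self_eq_norm_sq_to_K] at h
  have h2 : ((‖u‖ ^ 2 : ℝ) : ℂ) = ((∫ x, ‖u x‖ ^ 2 : ℝ) : ℂ) := by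
    rw [← integral_complex_ofReal]
    push_cast
    exact h
  exact_mod_cast h2.symm

/-- The sharp logarithmic Sobolev inequality in the energy space. -/
theorem integral_log_le {N : ℕ} {u : L2 N} (hu : u ∈ W N) :
    ∫ x, ‖u x‖ ^ 2 * Real.log (‖u x‖ ^ 2) ≤
      (∫ x, ‖weakGradient u x‖ ^ 2) + ‖u‖ ^ 2 * Real.log (‖u‖ ^ 2)
        - N * (1 + Real.log Real.pi / 2) * ‖u‖ ^ 2 := by
  obtain ⟨⟨g, hg⟩, hlog⟩ := hu
  have coord : ∀ i, MemLp (fun x => g x i) 2 (volume : Measure (Space N)) := fun i =>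
    (Lp.memLp g).continuousLinearMap_comp
      (EuclideanSpace.proj i : EuclideanSpace ℂ (Fin N) →L[ℂ] ℂ)
  have h := integral_log_le_of_isWeakGradient (Lp.memLp u) coord hg hlog
  rw [hg.weakGradient_eq]
  simp only [EuclideanSpace.norm_sq_eq]
  rw [integral_finsetSum _ fun i _ => (coord i).integrable_norm_pow two_ne_zero]
  rwa [integral_norm_sq_eq] at h

/-- The constraint rewrites the entropy as ∫ |∇u|² + ω‖u‖²; the logarithmic Sobolev inequality
cancels the gradient, and dividing by ‖u‖² > 0 bounds log ‖u‖² from below. -/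
theorem le_norm_sq_of_I_eq_zero {N : ℕ} {ω : ℝ} {u : L2 N} (hu : u ∈ W N) (hu0 : u ≠ 0)
    (hI : I ω u = 0) : Real.pi ^ ((N : ℝ) / 2) * Real.exp (ω + N) ≤ ‖u‖ ^ 2 := by
  have h := integral_log_le hu
  unfold I at hI
  rw [integral_norm_sq_eq] at hI
  have hm : 0 < ‖u‖ ^ 2 := by positivity
  have h1 : ‖u‖ ^ 2 * (ω + N + N * (Real.log Real.pi / 2)) ≤ ‖u‖ ^ 2 * Real.log (‖u‖ ^ 2) := by
    linarith
  have h2 := le_of_mul_le_mul_left h1 hm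
  rw [Real.le_log_iff_exp_le hm] at h2
  rw [Real.rpow_def_of_pos Real.pi_pos, ← Real.exp_add]
  refine le_trans (le_of_eq ?_) h2
  ring_nf

/-! ### Nonemptiness of the Nehari manifold and the bound on d(ω) -/

/-- Real test functions belong to the energy space. -/
theorem exists_mem_W_of_contDiff {N : ℕ} {v : Space N → ℝ} (hv : ContDiff ℝ (⊤ : ℕ∞) v)
    (hvc : HasCompactSupport v) :
    ∃ u ∈ W N, ‖u‖ ^ 2 = (∫ x, v x ^ 2) ∧ ∀ ω, I ω u =
      (∑ i, ∫ x, fderiv ℝ v x (EuclideanSpace.single i 1) ^ 2) + ω * (∫ x, v x ^ 2)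
        - ∫ x, v x ^ 2 * Real.log (v x ^ 2) := by
  have cv' : ∀ i, Continuous fun x => fderiv ℝ v x (EuclideanSpace.single i 1) := fun i =>
    (hv.continuous_fderiv (by simp)).clm_apply continuous_const
  have sv' : ∀ i, HasCompactSupport fun x => fderiv ℝ v x (EuclideanSpace.single i 1) :=
    fun i => hvc.fderiv_apply ℝ _
  have mv : MemLp (fun x => (v x : ℂ)) 2 (volume : Measure (Space N)) :=
    (Complex.continuous_ofReal.comp hv.continuous).memLp_of_hasCompactSupport
      (hvc.comp_left (g := fun t : ℝ => (t : ℂ)) (by simp))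
  have mg : MemLp (fun x => (WithLp.toLp 2 fun i =>
      ((fderiv ℝ v x (EuclideanSpace.single i 1) : ℝ) : ℂ) : EuclideanSpace ℂ (Fin N))) 2
      (volume : Measure (Space N)) := by
    refine Continuous.memLp_of_hasCompactSupport ?_ ?_
    · exact (PiLp.continuous_toLp 2 _).comp
        (continuous_pi fun i => Complex.continuous_ofReal.comp (cv' i))
    · exact (hvc.fderiv ℝ).comp_left (g := fun L : Space N →L[ℝ] ℝ => (WithLp.toLp 2 fun i =>
        ((L (EuclideanSpace.single i 1) : ℝ) : ℂ) : EuclideanSpace ℂ (Fin N)))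
        (by ext i; simp)
  have hue := mv.coeFn_toLp
  have hge := mg.coeFn_toLp
  have hsq : ∀ x, ‖(v x : ℂ)‖ ^ 2 = v x ^ 2 := fun x => by simp
  have hgrad : IsWeakGradient (mv.toLp _) (mg.toLp _) := by
    intro ψ hψ hψc i
    have cψ' : Continuous fun x => fderiv ℝ ψ x (EuclideanSpace.single i 1) :=
      (hψ.continuous_fderiv (by simp)).clm_apply continuous_const
    have e1 : ∫ x, (fderiv ℝ ψ x (EuclideanSpace.single i 1)) • mv.toLp _ x =
        ((∫ x, v x * fderiv ℝ ψ x (EuclideanSpace.single i 1) : ℝ) : ℂ) := by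
      rw [← integral_complex_ofReal]
      refine integral_congr_ae ?_
      filter_upwards [hue] with x hx
      rw [hx, Complex.real_smul]
      push_cast
      ring
    have e2 : ∫ x, ψ x • (mg.toLp _ x i) =
        ((∫ x, fderiv ℝ v x (EuclideanSpace.single i 1) * ψ x : ℝ) : ℂ) := by
      rw [← integral_complex_ofReal]
      refine integral_congr_ae ?_
      filter_upwards [hge] with x hx
      rw [hx, Complex.real_smul]
      push_cast
      ring
    rw [e1, e2, integral_mul_fderiv_eq_neg_fderiv_mul_of_integrable
      (((cv' i).mul hψ.continuous).integrable_of_hasCompactSupport hψc.mul_left)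
      ((hv.continuous.mul cψ').integrable_of_hasCompactSupport hvc.mul_right)
      ((hv.continuous.mul hψ.continuous).integrable_of_hasCompactSupport hvc.mul_right)
      (fun x _ => hv.differentiable (by simp) x) (fun x _ => hψ.differentiable (by simp) x)]
    push_cast
    rfl
  have hlog : (fun x => ‖mv.toLp _ x‖ ^ 2 * Real.log (‖mv.toLp _ x‖ ^ 2)) =ᵐ[volume]
      fun x => v x ^ 2 * Real.log (v x ^ 2) := by
    filter_upwards [hue] with x hx
    rw [hx, hsq]
  have hnorm : ∫ x, ‖mv.toLp _ x‖ ^ 2 = ∫ x, v x ^ 2 := by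
    refine integral_congr_ae ?_
    filter_upwards [hue] with x hx
    rw [hx, hsq]
  have hgn : ∫ x, ‖mg.toLp _ x‖ ^ 2 =
      ∑ i, ∫ x, fderiv ℝ v x (EuclideanSpace.single i 1) ^ 2 := by
    rw [← integral_finsetSum _ fun i _ => integrable_comp_of_hasCompactSupport
      (G := fun t : ℝ => t ^ 2) (cv' i) (sv' i) (continuous_pow 2) (by simp)]
    refine integral_congr_ae ?_
    filter_upwards [hge] with x hx
    rw [hx, EuclideanSpace.norm_sq_eq]
    simp
  refine ⟨mv.toLp _, ⟨⟨mg.toLp _, hgrad⟩, ?_⟩, ?_, fun ω => ?_⟩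
  · refine Integrable.congr ?_ hlog.symm
    exact integrable_comp_of_hasCompactSupport (G := fun t : ℝ => t ^ 2 * Real.log (t ^ 2))
      hv.continuous hvc (Real.continuous_mul_log.comp (continuous_pow 2)) (by simp)
  · rw [← integral_norm_sq_eq, hnorm]
  · rw [I, hgrad.weakGradient_eq, hgn, hnorm, integral_congr_ae hlog]

/-- Needed because the real infimum of the empty set is 0, which would contradict positivity. A
multiple c·b of a bump lies on the manifold for a suitable c, since I_ω(cb) = c² (I_ω(b) - m log c²)
with m = ∫ b². -/
theorem nehari_nonempty (N : ℕ) (ω : ℝ) : (nehari N ω).Nonempty := by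
  obtain ⟨b⟩ : Nonempty (ContDiffBump (0 : Space N)) := ⟨⟨1, 2, one_pos, one_lt_two⟩⟩
  have hb : ContDiff ℝ (⊤ : ℕ∞) b := b.contDiff
  have hbc : HasCompactSupport b := b.hasCompactSupport
  have hb1 : b 0 = 1 := b.one_of_mem_closedBall (by simp [b.rIn_pos.le])
  have i1 : Integrable fun x => b x ^ 2 :=
    integrable_comp_of_hasCompactSupport (G := fun t : ℝ => t ^ 2) hb.continuous hbc
      (continuous_pow 2) (by simp)
  have i2 : Integrable fun x => b x ^ 2 * Real.log (b x ^ 2) :=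
    integrable_comp_of_hasCompactSupport (G := fun t : ℝ => t ^ 2 * Real.log (t ^ 2))
      hb.continuous hbc (Real.continuous_mul_log.comp (continuous_pow 2)) (by simp)
  obtain ⟨m, hm⟩ : ∃ m, m = ∫ x, b x ^ 2 := ⟨_, rfl⟩
  obtain ⟨A, hA⟩ : ∃ A, A = ∑ i, ∫ x, fderiv ℝ b x (EuclideanSpace.single i 1) ^ 2 := ⟨_, rfl⟩
  obtain ⟨E, hE⟩ : ∃ E, E = ∫ x, b x ^ 2 * Real.log (b x ^ 2) := ⟨_, rfl⟩
  have hm0 : 0 < m := by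
    rw [hm]
    exact (hb.continuous.pow 2).integral_pos_of_hasCompactSupport_nonneg_nonzero
      (hasCompactSupport_comp (G := fun t : ℝ => t ^ 2) hbc (by simp)) (fun x => sq_nonneg _)
      (x := 0) (by simp [hb1])
  -- `t` is the value of log c² that makes I_ω(cb) vanish, namely I_ω(b)/m.
  obtain ⟨t, ht⟩ : ∃ t, t = (A + ω * m - E) / m := ⟨_, rfl⟩
  have htm : t * m = A + ω * m - E := by rw [ht]; field_simp
  obtain ⟨c, hc⟩ : ∃ c, c = Real.exp (t / 2) := ⟨_, rfl⟩
  have hc0 : 0 < c := hc ▸ Real.exp_pos _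
  have hlogc : Real.log (c ^ 2) = t := by rw [hc, Real.log_pow, Real.log_exp]; push_cast; ring
  obtain ⟨u, huW, hun, huI⟩ := exists_mem_W_of_contDiff (v := fun x => c * b x)
    (contDiff_const.mul hb) hbc.mul_left
  have e1 : ∫ x, (c * b x) ^ 2 = c ^ 2 * m := by
    simp only [mul_pow]
    rw [integral_const_mul, hm]
  have e2 : ∑ i, ∫ x, fderiv ℝ (fun x => c * b x) x (EuclideanSpace.single i 1) ^ 2
      = c ^ 2 * A := by
    rw [hA, Finset.mul_sum]
    refine Finset.sum_congr rfl fun i _ => ?_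
    rw [← integral_const_mul]
    refine integral_congr_ae (Filter.Eventually.of_forall fun x => ?_)
    simp only
    rw [fderiv_const_mul (hb.differentiable (by simp) x)]
    simp [mul_pow]
  have e3 : ∫ x, (c * b x) ^ 2 * Real.log ((c * b x) ^ 2) = c ^ 2 * (E + t * m) := by
    rw [hE, hm, ← integral_const_mul t, ← integral_add i2 (i1.const_mul t), ← integral_const_mul]
    refine integral_congr_ae (Filter.Eventually.of_forall fun x => ?_)
    simp only
    by_cases hx : b x = 0
    · simp [hx]
    · rw [mul_pow, Real.log_mul (by positivity) (by positivity), hlogc]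
      ring
  refine ⟨u, huW, ?_, ?_⟩
  · rintro rfl
    rw [e1] at hun
    simp only [norm_zero] at hun
    have : 0 < c ^ 2 * m := by positivity
    linarith
  · rw [huI, e1, e2, e3, htm]
    ring

theorem half_mul_le_d (N : ℕ) (ω : ℝ) :
    (1 / 2) * Real.pi ^ ((N : ℝ) / 2) * Real.exp (ω + N) ≤ d N ω := by
  rw [d_eq_half_sInf, mul_assoc]
  refine mul_le_mul_of_nonneg_left (le_csInf ((nehari_nonempty N ω).image _) ?_) (by norm_num)
  rintro _ ⟨u, ⟨huW, hu0, huI⟩, rfl⟩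
  exact le_norm_sq_of_I_eq_zero huW hu0 huI

end LogNLS

theorem lemma2p2 (N : ℕ) (hN : 1 ≤ N) (ω : ℝ) :
    (∀ u ∈ LogNLS.W N, u ≠ 0 → LogNLS.I ω u = 0 →
      Real.pi ^ ((N : ℝ) / 2) * Real.exp (ω + N) ≤ ‖u‖ ^ 2) ∧
    (1 / 2) * Real.pi ^ ((N : ℝ) / 2) * Real.exp (ω + N) ≤ LogNLS.d N ω ∧
    0 < LogNLS.d N ω :=
  ⟨fun _ huW hu0 huI => LogNLS.le_norm_sq_of_I_eq_zero huW hu0 huI, LogNLS.half_mul_le_d N ω,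
    lt_of_lt_of_le (by positivity) (LogNLS.half_mul_le_d N ω)⟩
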